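/- \textbf{Compressions.} All trees are rooted and ordered. A \emph{halving compression} of a path $C=(u_1,\dots,u_k)$, where $u_{i+1}$ is the parent of $u_i$, makes $u_{i+2}$ the parent of $u_i$ for all odd $i\le k-2$; if $k$ is even it may also make the parent of $u_k$ the parent of $u_{k-1}$ (so that $u_{k-1}$ becomes a root if $u_k$ is one). A \emph{total compression} of $C$ makes $u_k$ the parent of $u_1,\dots,u_{k-2}$. All compressions considered preserve the postorder of the nodes and alter at least one parent pointer. The \emph{spine} is the path from the leftmost leaf to the root of its tree; a compression is \emph{spinal} if $C$ lies on the spine. \textbf{Spinal compression systems.} The initial structure is a single path of essential and fluff nodes whose bottom node is essential. A finite sequence of operations is performed, each of which is an official compression (halving and spinal), a spontaneous compression (an arbitrary halving or total postorder-preserving compression), or the deletion of the leftmost leaf. Whenever a fluff node becomes a leaf it is deleted automatically, so all leaves are essential. \textbf{Blocks and epochs.} Fix $B\ge 1$. The initial path is divided, from bottom to top, into blocks of $B$ essential nodes each (the last block may have fewer), the bottommost node of each block being essential. Epoch $j$ consists of the official compressions performed while the leftmost leaf belongs to block $j$, and commences just before the first of them. Let $I_j$ be the path formed at the commencement of epoch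 $j$ by the nodes outside block $j$ that are touched by (lie on the path of) some compression of epoch $j$; if these nodes are not contiguous at that time, $I_j$ is the shortest path containing all of them. At the commencement of epoch $j$ an essential node $v$ is \emph{exposed} if it has no essential proper ancestor that lies in the same block as $v$ or is affiliated with a common epoch $i<j$. Let $\hat I_j\subseteq I_j$ be the set of essential exposed nodes of $I_j$. Epoch $j$ is \emph{sparse} if $|\hat I_j|\log_2|\hat I_j|<|I_j|$ and \emph{dense} otherwise. If epoch $j$ is dense, all nodes of $I_j$ become affiliated with $j$; otherwise none do. \textbf{Transcription.} The label of a node $v$ is the list, in descending order, of all dense epochs $j$ with $v\in\hat I_j$. Let $\mathscr{S}'$ be the concatenation of the labels of all nodes, the nodes being taken in the postorder of the initial path. \textbf{Lemma.} For every execution of a spinal compression system and every $B\ge1$, no subsequence of $\mathscr{S}'$ is isomorphic (equal up to an injective renaming of symbols) to $abaabba$ or to $abababa$. Moreover, for all epochs $a<b$, the sequence $b\,a\,b\,b\,a$ is not a subsequence of $\mathscr{S}'$. -/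

import Mathlib

namespace SpinalCompression

/-! ### Ordered forests, compressions -/

/-- A rooted ordered forest whose nodes are named by their postorder numbers: `alive` is the set of
nodes that are present, and `parent u` (read only for `u ∈ alive`) is the parent of `u`, `none` for
a root. Siblings (and roots) are ordered from left to right by their names, so the parent function
together with the postorder determines the ordered forest; see `Forest.Postordered`. -/
structure Forest (N : ℕ) where
  alive : Set (Fin N)
  parent : Fin N → Option (Fin N)

namespace Forest

variable {N : ℕ}

/-- `u` is a child of `w`. -/
def Child (F : Forest N) (u w : Fin N) : Prop := u ∈ F.alive ∧ F.parent u = some w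

/-- `w` is a proper ancestor of `u`. -/
def Anc (F : Forest N) (u w : Fin N) : Prop := Relation.TransGen F.Child u w

/-- `w` is `u` or an ancestor of `u`. -/
def AncEq (F : Forest N) (u w : Fin N) : Prop := Relation.ReflTransGen F.Child u w

/-- The usual order on names is a postorder of the forest: the parent of a node is a later node of
the forest, and the nodes of each subtree are consecutive, the root of the subtree coming last. -/
def Postordered (F : Forest N) : Prop :=
  (∀ u w, F.Child u w → w ∈ F.alive ∧ u < w) ∧
  ∀ u v w, v ∈ F.alive → F.Anc u w → u < v → v < w → F.Anc v w

/-- The leftmost leaf of the forest is its first node in postorder. -/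
def IsLeftmostLeaf (F : Forest N) (v : Fin N) : Prop := v ∈ F.alive ∧ ∀ u ∈ F.alive, v ≤ u

/-- The spine: the path from the leftmost leaf to the root of its tree. -/
def OnSpine (F : Forest N) (v : Fin N) : Prop := ∃ l, F.IsLeftmostLeaf l ∧ F.AncEq l v

/-- `C = (u₁, …, u_k)` is a path of the forest, each node followed by its parent. -/
def IsPath (F : Forest N) (C : List (Fin N)) : Prop :=
  (∀ u ∈ C, u ∈ F.alive) ∧ C.IsChain F.Child

/-- The parent function after a halving compression of `(u₁, …, u_k)`: the parent of `u_i` becomes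
`u_{i+2}` for all odd `i ≤ k - 2`; if `k` is even and `flip` is set, the parent of `u_{k-1}` becomes
the parent of `u_k` (so `u_{k-1}` becomes a root if `u_k` is one). -/
def halvingParent (p : Fin N → Option (Fin N)) (flip : Bool) :
    List (Fin N) → Fin N → Option (Fin N)
  | u :: _ :: w :: C => Function.update (halvingParent p flip (w :: C)) u (some w)
  | [u, x] => if flip then Function.update p u (p x) else p
  | _ => p

/-- Halving compression of the path `C`. -/
def halving (F : Forest N) (C : List (Fin N)) (flip : Bool) : Forest N where
  alive := F.alive
  parent := halvingParent F.parent flip C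

/-- Total compression of the path `(u₁, …, u_k)`: the parent of `u₁, …, u_{k-2}` becomes `u_k`. -/
def total (F : Forest N) (C : List (Fin N)) : Forest N where
  alive := F.alive
  parent := fun u => if u ∈ C.dropLast.dropLast then C.getLast? else F.parent u

/-- The passage from `F` to `F'` is a postorder-preserving compression of a path `C` of `F`, of
nonzero length (some parent pointer is altered). -/
def IsCompression (F : Forest N) (C : List (Fin N)) (F' : Forest N) : Prop :=
  F.IsPath C ∧ F'.parent ≠ F.parent ∧ F'.Postordered

/-- Automatic deletion of fluff leaves, repeated until every leaf is essential: the nodes that stay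
are those with an essential node in their subtree. -/
def prune (ess : Fin N → Prop) (F : Forest N) : Forest N where
  alive := {v | v ∈ F.alive ∧ ∃ e ∈ F.alive, ess e ∧ F.AncEq e v}
  parent := F.parent

/-- Deletion of the node `v`. -/
def delete (F : Forest N) (v : Fin N) : Forest N where
  alive := F.alive \ {v}
  parent := F.parent

/-- A single path; node `0` is its leaf and node `N - 1` its root. -/
def path (N : ℕ) : Forest N where
  alive := Set.univ
  parent := fun v => if h : (v : ℕ) + 1 < N then some ⟨v + 1, h⟩ else none

end Forest

/-! ### Executions of a spinal compression system -/

/-- The operations. Only official compressions count towards the cost. -/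
inductive Op (N : ℕ) where
  | official (C : List (Fin N)) (flip : Bool)
  | spontaneousHalving (C : List (Fin N)) (flip : Bool)
  | spontaneousTotal (C : List (Fin N))
  | deleteLeaf

/-- One operation, followed by the automatic deletion of fluff leaves. Official compressions are
halving and spinal; spontaneous ones are arbitrary postorder-preserving compressions; the leftmost
essential node (which is the leftmost leaf) may be deleted. -/
inductive Step {N : ℕ} (ess : Fin N → Prop) (F : Forest N) : Op N → Forest N → Prop where
  | official (C : List (Fin N)) (flip : Bool)
      (hC : F.IsCompression C (F.halving C flip)) (hspine : ∀ u ∈ C, F.OnSpine u) :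
      Step ess F (Op.official C flip) ((F.halving C flip).prune ess)
  | spontaneousHalving (C : List (Fin N)) (flip : Bool)
      (hC : F.IsCompression C (F.halving C flip)) :
      Step ess F (Op.spontaneousHalving C flip) ((F.halving C flip).prune ess)
  | spontaneousTotal (C : List (Fin N))
      (hC : F.IsCompression C (F.total C)) :
      Step ess F (Op.spontaneousTotal C) ((F.total C).prune ess)
  | deleteLeaf (v : Fin N) (hv : F.IsLeftmostLeaf v) (hess : ess v) :
      Step ess F Op.deleteLeaf ((F.delete v).prune ess)

/-- A finite execution: `len` operations, `op t` leading from `state t` to `state (t + 1)`, starting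
from a single path on `N` nodes, of which those satisfying `ess` are essential, the others fluff. -/
structure Execution {N : ℕ} (ess : Fin N → Prop) where
  len : ℕ
  state : ℕ → Forest N
  op : ℕ → Op N
  init : state 0 = Forest.path N
  step : ∀ t < len, Step ess (state t) (op t) (state (t + 1))

/-! ### Blocks, epochs, affiliations, transcription -/

/-- Index (from `0`) of the block of `v`, when the initial path is divided from bottom to top into
blocks with `B` essential nodes each, the bottommost node of each block being essential.
(If `B` does not divide the number of essential nodes then the last block has fewer.) -/
noncomputable def block {N : ℕ} (ess : Fin N → Prop) (B : ℕ) (v : Fin N) : ℕ :=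
  ({u | ess u ∧ u ≤ v}.ncard - 1) / B

/-- The number of blocks, `n / B` rounded up, where `n` is the number of essential nodes. -/
noncomputable def numBlocks {N : ℕ} (ess : Fin N → Prop) (B : ℕ) : ℕ :=
  ({u | ess u}.ncard + B - 1) / B

namespace Execution

variable {N : ℕ} {ess : Fin N → Prop} (E : Execution ess) (B : ℕ)

/-- Operation number `t` is an official compression of the path `C`, belonging to epoch `j`: it is
performed when the leftmost leaf lies in block `j`. -/
def InEpoch (j t : ℕ) (C : List (Fin N)) : Prop :=
  t < E.len ∧ (∃ flip, E.op t = Op.official C flip) ∧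
    ∃ l, (E.state t).IsLeftmostLeaf l ∧ block ess B l = j

/-- Epoch `j` commences with operation number `t`; `E.state t` is the forest at that time. -/
def Commences (j t : ℕ) : Prop :=
  (∃ C, E.InEpoch B j t C) ∧ ∀ s < t, ∀ C, ¬ E.InEpoch B j s C

/-- `v` lies outside block `j` and is touched by a compression in epoch `j`. -/
def Touched (j : ℕ) (v : Fin N) : Prop :=
  block ess B v ≠ j ∧ ∃ t C, E.InEpoch B j t C ∧ v ∈ C

/-- The path `I_j`: the shortest path, at the commencement of epoch `j`, that contains all nodes
outside block `j` touched by compressions in epoch `j`. It consists of just these nodes whenever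
they form a path, see `I_eq_touched`. -/
def I (j : ℕ) : Set (Fin N) :=
  {v | ∃ t, E.Commences B j t ∧ ∃ u w, E.Touched B j u ∧ E.Touched B j w ∧
    (E.state t).AncEq u v ∧ (E.state t).AncEq v w}

/-- If the touched nodes outside block `j` are already contiguous at the commencement of epoch `j`
then `I_j` is the set of these nodes. -/
theorem I_eq_touched (j : ℕ)
    (h : ∀ t u v w, E.Commences B j t → E.Touched B j u → E.Touched B j w →
      (E.state t).AncEq u v → (E.state t).AncEq v w → E.Touched B j v) :
    E.I B j = {v | E.Touched B j v} := by
  classical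
  ext v
  constructor
  · rintro ⟨t, ht, u, w, hu, hw, huv, hvw⟩
    exact h t u v w ht hu hw huv hvw
  · intro hv
    have hex : ∃ t, ∃ C, E.InEpoch B j t C := by
      obtain ⟨_, t, C, hC, _⟩ := hv
      exact ⟨t, C, hC⟩
    exact ⟨Nat.find hex, ⟨Nat.find_spec hex, fun s hs C hC => Nat.find_min hex hs ⟨C, hC⟩⟩,
      v, v, hv, hv, Relation.ReflTransGen.refl, Relation.ReflTransGen.refl⟩

/-- The essential nodes of `I_j` that are exposed at the commencement of epoch `j`, if `aff i` is
the set of nodes affiliated with `i`, for `i < j`: those with no essential ancestor that lies in the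
same block or shares an affiliation. -/
def exposedGiven (j : ℕ) (aff : ∀ i, i < j → Set (Fin N)) : Set (Fin N) :=
  {v | v ∈ E.I B j ∧ ess v ∧ ∃ t, E.Commences B j t ∧
    ∀ w, (E.state t).Anc v w → ess w →
      ¬ (block ess B w = block ess B v ∨ ∃ i, ∃ hi : i < j, v ∈ aff i hi ∧ w ∈ aff i hi)}

open Classical in
/-- The set of nodes affiliated with epoch `j`: all of `I_j` if the epoch is dense, otherwise none;
see `affiliated_eq`. -/
noncomputable def affiliated (j : ℕ) : Set (Fin N) :=
  if ((E.exposedGiven B j (fun i _ => affiliated i)).ncard : ℝ) *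
      Real.logb 2 (E.exposedGiven B j (fun i _ => affiliated i)).ncard < (E.I B j).ncard
  then ∅ else E.I B j
termination_by j

/-- The set `Î_j` of essential exposed nodes of `I_j`. -/
noncomputable def exposed (j : ℕ) : Set (Fin N) :=
  E.exposedGiven B j (fun i _ => E.affiliated B i)

/-- Epoch `j` is sparse if `|Î_j| log |Î_j| < |I_j|`, and dense otherwise. -/
def Dense (j : ℕ) : Prop :=
  ¬ ((E.exposed B j).ncard : ℝ) * Real.logb 2 (E.exposed B j).ncard < (E.I B j).ncard

open Classical in
theorem affiliated_eq (j : ℕ) : E.affiliated B j = if E.Dense B j then E.I B j else ∅ := by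
  rw [affiliated, Dense, exposed]
  split_ifs <;> rfl

open Classical in
/-- The label of `v`: the dense epochs `j` with `v ∈ Î_j`, in descending order. -/
noncomputable def label (v : Fin N) : List ℕ :=
  ((List.range (numBlocks ess B)).filter (fun j => E.Dense B j ∧ v ∈ E.exposed B j)).reverse

/-- The transcription `S'`: the concatenation of all labels, the nodes being taken in postorder. -/
noncomputable def transcription : List ℕ := (List.finRange N).flatMap (E.label B)

end Execution

/-- `σ ≺ S`: the sequence `σ` is isomorphic to (equal, up to renaming of symbols, to) a subsequence
of `S`. -/
def IsoSubsequence {α β : Type*} (σ : List α) (S : List β) : Prop :=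
  ∃ f : α → β, Set.InjOn f {x | x ∈ σ} ∧ (σ.map f).Sublist S

end SpinalCompression

namespace SpinalCompression

/-! ### Ancestry and postorder in ordered forests, and how compressions and deletions affect them.
-/

namespace Forest

variable {N : ℕ} {F F' : Forest N}

/-! Everything reduces to excluding `b a b b a` for `a < b`: both seven-letter patterns contain
`babba` and `abaab`, so whichever symbol names the later epoch, one of these is the excluded
sequence.

Suppose nodes `v₁, …, v₅` carry these symbols. When `b` commences, `I_b` is a chain
(`anc_of_mem_I`), so `v₁` lies below `v₃`, and `v₃` below `v₄`. Operations never create ancestries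
(`anc_antitone`) and `a` commences no later than `b`, so `v₁` lay below `v₃` and `v₄` already when
`a` commenced. By postorder, `v₂`, which lies between, was also below them. Then `v₃` and `v₄` were
on the path from `v₂` to `v₅`, hence in `I_a`, and `a` is dense, so both are affiliated with `a`.
Thus `v₄` is an essential ancestor of `v₃` with a shared affiliation, and `v₃` is not exposed in
epoch `b` (`false_of_interleaved`). -/

theorem Anc.alive_left {u w : Fin N} (h : F.Anc u w) : u ∈ F.alive := by
  induction h using Relation.TransGen.head_induction_on with
  | single h => exact h.1
  | head h _ _ => exact h.1

theorem Postordered.anc_lt (hF : F.Postordered) {u w : Fin N} (h : F.Anc u w) : u < w := by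
  induction h with
  | single h => exact (hF.1 _ _ h).2
  | tail _ h ih => exact ih.trans (hF.1 _ _ h).2

theorem AncEq.eq_or_anc {u w : Fin N} (h : F.AncEq u w) : u = w ∨ F.Anc u w := by
  rcases Relation.reflTransGen_iff_eq_or_transGen.1 h with h | h
  · exact Or.inl h.symm
  · exact Or.inr h

theorem Anc.ancEq {u w : Fin N} (h : F.Anc u w) : F.AncEq u w :=
  Relation.TransGen.to_reflTransGen h

theorem Postordered.ancEq_le (hF : F.Postordered) {u w : Fin N} (h : F.AncEq u w) : u ≤ w := by
  rcases h.eq_or_anc with rfl | h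
  · exact le_rfl
  · exact (hF.anc_lt h).le

/-- The ancestors of a node form a chain. -/
theorem Postordered.anc_of_common (hF : F.Postordered) {l v w : Fin N} (hv : F.AncEq l v)
    (hw : F.AncEq l w) (h : v < w) : F.Anc v w := by
  have hU : Relator.RightUnique F.Child := fun a b c hb hc =>
    Option.some_injective _ (hb.2.symm.trans hc.2)
  rcases Relation.ReflTransGen.total_of_right_unique hU hv hw with h' | h'
  · rcases AncEq.eq_or_anc h' with rfl | h'
    · exact absurd h (lt_irrefl _)
    · exact h'
  · exact absurd (hF.ancEq_le h') (not_le.2 h)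

/-- An ancestor of `u` is an ancestor of all nodes between `u` and itself. -/
theorem Postordered.anc_of_le_of_lt (hF : F.Postordered) {u v w : Fin N} (hv : v ∈ F.alive)
    (h : F.Anc u w) (huv : u ≤ v) (hvw : v < w) : F.Anc v w := by
  rcases huv.eq_or_lt with rfl | huv
  · exact h
  · exact hF.2 u v w hv h huv hvw

theorem Anc.of_child (h : ∀ u w, F'.Child u w → F.Anc u w) {u w : Fin N} (hu : F'.Anc u w) :
    F.Anc u w := by
  induction hu with
  | single h' => exact h _ _ h'
  | tail _ h' ih => exact ih.trans (h _ _ h')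

/-- The surviving nodes are closed under taking ancestors, so ancestries between survivors are not
interrupted. -/
theorem Postordered.prune (hF : F.Postordered) (ess : Fin N → Prop) :
    (F.prune ess).Postordered := by
  have hsub : ∀ u w, (F.prune ess).Child u w → F.Child u w := fun u w h => ⟨h.1.1, h.2⟩
  have hup : ∀ u w, F.Anc u w → u ∈ (F.prune ess).alive → (F.prune ess).Anc u w := by
    intro u w h
    induction h using Relation.TransGen.head_induction_on with
    | single h => exact fun hu => .single ⟨hu, h.2⟩
    | head h _ ih =>
      rintro ⟨hu, e, he, hee, heu⟩
      exact .head ⟨⟨hu, e, he, hee, heu⟩, h.2⟩ (ih ⟨(hF.1 _ _ h).1, e, he, hee, heu.tail h⟩)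
  refine ⟨fun u w h => ?_, fun u v w hv h huv hvw => ?_⟩
  · have hc := hsub u w h
    obtain ⟨⟨_, e, he, hee, heu⟩, _⟩ := h
    exact ⟨⟨(hF.1 _ _ hc).1, e, he, hee, heu.tail hc⟩, (hF.1 _ _ hc).2⟩
  · exact hup v w (hF.2 u v w hv.1 (h.of_child fun u w h => .single (hsub u w h)) huv hvw) hv

/-- Parents come later than their children, so the first node is nobody's parent and no other
ancestry passes through it. -/
theorem Postordered.delete (hF : F.Postordered) {l : Fin N} (hl : F.IsLeftmostLeaf l) :
    (F.delete l).Postordered := by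
  have hsub : ∀ u w, (F.delete l).Child u w → F.Child u w := fun u w h => ⟨h.1.1, h.2⟩
  have hne : ∀ u w, F.Child u w → w ≠ l := by
    intro u w h hw
    exact absurd (hl.2 u h.1) (not_le.2 (hw ▸ (hF.1 _ _ h).2))
  have hup : ∀ u w, F.Anc u w → u ≠ l → (F.delete l).Anc u w := by
    intro u w h
    induction h using Relation.TransGen.head_induction_on with
    | single h => exact fun hu => .single ⟨⟨h.1, hu⟩, h.2⟩
    | head h _ ih => exact fun hu => .head ⟨⟨h.1, hu⟩, h.2⟩ (ih (hne _ _ h))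
  refine ⟨fun u w h => ?_, fun u v w hv h huv hvw => ?_⟩
  · have hc := hsub u w h
    exact ⟨⟨(hF.1 _ _ hc).1, hne _ _ hc⟩, (hF.1 _ _ hc).2⟩
  · exact hup v w (hF.2 u v w hv.1 (h.of_child fun u w h => .single (hsub u w h)) huv hvw) hv.2

theorem path_anc_of_lt {u w : Fin N} (h : u < w) : (path N).Anc u w := by
  obtain ⟨k, hk⟩ : ∃ k, (w : ℕ) = u + k + 1 := ⟨w - u - 1, by have : (u : ℕ) < w := h; omega⟩
  induction k generalizing w with
  | zero =>
    refine .single ⟨trivial, ?_⟩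
    have : (u : ℕ) + 1 < N := by have := w.2; omega
    simp only [path, this, dite_true, Option.some.injEq]
    exact Fin.ext hk.symm
  | succ k ih =>
    have hw := w.2
    refine (ih (w := ⟨u + k + 1, by omega⟩) (Fin.lt_def.2 (by simp only; omega)) rfl).tail
      ⟨trivial, ?_⟩
    have : (u : ℕ) + k + 1 + 1 < N := by omega
    simp only [path, this, dite_true, Option.some.injEq]
    exact Fin.ext hk.symm

theorem path_postordered (N : ℕ) : (path N).Postordered := by
  refine ⟨fun u w h => ⟨trivial, ?_⟩, fun _ _ _ _ _ _ h => path_anc_of_lt h⟩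
  have h := h.2
  simp only [path] at h
  split_ifs at h
  rw [← Option.some.inj h]
  exact Fin.lt_def.2 (Nat.lt_succ_self _)

/-- Each redirected pointer goes from a node to its old grandparent, so no new ancestry arises. -/
theorem halving_child_anc {flip : Bool} {C : List (Fin N)} (hC : F.IsPath C) {u w : Fin N}
    (h : (F.halving C flip).Child u w) : F.Anc u w := by
  obtain ⟨hu, h⟩ := h
  change u ∈ F.alive at hu
  change halvingParent F.parent flip C u = some w at h
  fun_induction halvingParent F.parent flip C with
  | case1 a x y C ih =>
    obtain ⟨hal, hC⟩ := hC
    simp only [List.isChain_cons_cons] at hC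
    by_cases hua : u = a
    · subst hua
      rw [Function.update_self, Option.some.injEq] at h
      subst h
      exact .tail (.single hC.1) hC.2.1
    · rw [Function.update_of_ne hua] at h
      exact ih ⟨fun v hv => hal v (List.mem_cons_of_mem _ (List.mem_cons_of_mem _ hv)), hC.2.2⟩ h
  | case2 a x =>
    obtain ⟨hal, hC⟩ := hC
    simp only [List.isChain_cons_cons] at hC
    by_cases hua : u = a
    · subst hua
      rw [Function.update_self] at h
      exact .tail (.single hC.1) ⟨hal x (by simp), h⟩
    · rw [Function.update_of_ne hua] at h
      exact .single ⟨hu, h⟩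
  | case3 => exact .single ⟨hu, h⟩
  | case4 => exact .single ⟨hu, h⟩

theorem IsPath.anc_getLast {C : List (Fin N)} (hC : F.IsPath C) {u w : Fin N}
    (hu : u ∈ C.dropLast) (hw : C.getLast? = some w) : F.Anc u w := by
  have hp : C.Pairwise F.Anc := by
    have : IsTrans (Fin N) F.Anc := ⟨fun _ _ _ h h' => Relation.TransGen.trans h h'⟩
    exact List.isChain_iff_pairwise.1 (hC.2.imp fun _ _ h => .single h)
  obtain ⟨D, rfl⟩ := List.getLast?_eq_some_iff.1 hw
  rw [List.dropLast_concat] at hu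
  exact (List.pairwise_append.1 hp).2.2 u hu w (by simp)

theorem total_child_anc {C : List (Fin N)} (hC : F.IsPath C) {u w : Fin N}
    (h : (F.total C).Child u w) : F.Anc u w := by
  obtain ⟨hu, h⟩ := h
  change (if u ∈ C.dropLast.dropLast then C.getLast? else F.parent u) = some w at h
  split_ifs at h with huC
  · exact hC.anc_getLast (List.mem_of_mem_dropLast huC) h
  · exact .single ⟨hu, h⟩

end Forest

/-! ### Effect of a single operation. -/

section Step

variable {N : ℕ} {ess : Fin N → Prop} {F F' : Forest N} {o : Op N}

theorem Step.postordered (h : Step ess F o F') (hF : F.Postordered) : F'.Postordered := by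
  cases h with
  | official C flip hC _ => exact hC.2.2.prune ess
  | spontaneousHalving C flip hC => exact hC.2.2.prune ess
  | spontaneousTotal C hC => exact hC.2.2.prune ess
  | deleteLeaf v hv _ => exact (hF.delete hv).prune ess

theorem Step.alive_subset (h : Step ess F o F') : F'.alive ⊆ F.alive := by
  cases h with
  | official C flip hC _ => exact fun v hv => hv.1
  | spontaneousHalving C flip hC => exact fun v hv => hv.1
  | spontaneousTotal C hC => exact fun v hv => hv.1
  | deleteLeaf v hv _ => exact fun v hv => hv.1.1

theorem Step.anc (h : Step ess F o F') {u w : Fin N} (huw : F'.Anc u w) : F.Anc u w := by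
  refine huw.of_child fun u w huw => ?_
  cases h with
  | official C flip hC _ => exact Forest.halving_child_anc hC.1 ⟨huw.1.1, huw.2⟩
  | spontaneousHalving C flip hC => exact Forest.halving_child_anc hC.1 ⟨huw.1.1, huw.2⟩
  | spontaneousTotal C hC => exact Forest.total_child_anc hC.1 ⟨huw.1.1, huw.2⟩
  | deleteLeaf v hv _ => exact .single ⟨huw.1.1.1, huw.2⟩

end Step

theorem block_mono {N : ℕ} (ess : Fin N → Prop) (B : ℕ) : Monotone (block ess B) := by
  intro u v h
  refine Nat.div_le_div_right (Nat.sub_le_sub_right (Set.ncard_le_ncard ?_ (Set.toFinite _)) 1)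
  exact fun x hx => ⟨hx.1, hx.2.trans h⟩

/-! ### Executions: the structure of `I_j` and the forbidden interleaving. -/

namespace Execution

variable {N : ℕ} {ess : Fin N → Prop} (E : Execution ess) {B : ℕ}

theorem postordered {t : ℕ} (ht : t ≤ E.len) : (E.state t).Postordered := by
  induction t with
  | zero => rw [E.init]; exact Forest.path_postordered N
  | succ t ih => exact (E.step t ht).postordered (ih (Nat.le_of_succ_le ht))

theorem alive_antitone {s t : ℕ} (hst : s ≤ t) (ht : t ≤ E.len) :
    (E.state t).alive ⊆ (E.state s).alive := by
  induction t, hst using Nat.le_induction with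
  | base => exact subset_rfl
  | succ t _ ih => exact (E.step t ht).alive_subset.trans (ih (Nat.le_of_succ_le ht))

/-- Ancestries are only ever lost. -/
theorem anc_antitone {s t : ℕ} (hst : s ≤ t) (ht : t ≤ E.len) {u w : Fin N}
    (h : (E.state t).Anc u w) : (E.state s).Anc u w := by
  induction t, hst using Nat.le_induction with
  | base => exact h
  | succ t _ ih => exact ih (Nat.le_of_succ_le ht) ((E.step t ht).anc h)

variable {E}

theorem Commences.lt_len {j t : ℕ} (h : E.Commences B j t) : t < E.len := by
  obtain ⟨⟨_, h, _⟩, _⟩ := h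
  exact h

theorem Commences.unique {j s t : ℕ} (hs : E.Commences B j s) (ht : E.Commences B j t) :
    s = t := by
  obtain ⟨⟨C, hC⟩, hs⟩ := hs
  obtain ⟨⟨D, hD⟩, ht⟩ := ht
  exact le_antisymm (not_lt.1 fun h => hs _ h _ hD) (not_lt.1 fun h => ht _ h _ hC)

/-- Nodes only disappear, so the leftmost leaf, and with it the block containing it, never moves
backwards. -/
theorem Commences.le_of_lt {a b s t : ℕ} (hs : E.Commences B a s) (ht : E.Commences B b t)
    (hab : a < b) : s ≤ t := by
  by_contra! h
  obtain ⟨⟨_, hsl, _, l, hl, rfl⟩, _⟩ := hs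
  obtain ⟨⟨_, _, _, m, hm, rfl⟩, _⟩ := ht
  exact absurd (block_mono ess B (hm.2 l (E.alive_antitone h.le hsl.le hl.1))) (not_le.2 hab)

/-- At the commencement of epoch `j`, a touched node outside block `j` lies above block `j` and is
an ancestor of a node in block `j`. -/
theorem Touched.exists_anc {j t : ℕ} {v : Fin N} (hv : E.Touched B j v)
    (ht : E.Commences B j t) : j < block ess B v ∧
      ∃ l, block ess B l = j ∧ (E.state t).Anc l v := by
  obtain ⟨hvj, s, C, hs, hvC⟩ := hv
  have hts : t ≤ s := not_lt.1 fun h => ht.2 s h C hs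
  obtain ⟨hsl, ⟨flip, hop⟩, l, hl, hlj⟩ := hs
  -- Official compressions are spinal, so at time `s` the node `v` is above the leftmost leaf, which
  -- lies in block `j`; this ancestry is then carried back to time `t`.
  have hsp : (E.state s).OnSpine v := by
    have hstep := E.step s hsl
    generalize E.state (s + 1) = F' at hstep
    rw [hop] at hstep
    cases hstep with
    | official _ _ _ hspine => exact hspine v hvC
  obtain ⟨m, hm, hmv⟩ := hsp
  obtain rfl : m = l := le_antisymm (hm.2 l hl.1) (hl.2 m hm.1)
  rcases hmv.eq_or_anc with rfl | hmv
  · exact absurd hlj hvj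
  · have := block_mono ess B ((E.postordered hsl.le).anc_lt hmv).le
    exact ⟨lt_of_le_of_ne (hlj ▸ this) (Ne.symm hvj), m, hlj, E.anc_antitone hts hsl.le hmv⟩

theorem exists_anc_of_mem_I {j t : ℕ} {v : Fin N} (hv : v ∈ E.I B j) (ht : E.Commences B j t) :
    j < block ess B v ∧ ∃ l, block ess B l = j ∧ (E.state t).Anc l v := by
  obtain ⟨s, hs, u, w, hu, hw, huv, hvw⟩ := hv
  obtain rfl := hs.unique ht
  obtain ⟨hj, l, hl, hlu⟩ := hu.exists_anc ht
  exact ⟨hj.trans_le (block_mono ess B ((E.postordered ht.lt_len.le).ancEq_le huv)), l, hl,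
    Relation.TransGen.trans_left hlu huv⟩

/-- At the commencement of epoch `j`, the nodes of `I_j` form a chain. -/
theorem anc_of_mem_I {j t : ℕ} {v w : Fin N} (ht : E.Commences B j t) (hv : v ∈ E.I B j)
    (hw : w ∈ E.I B j) (hvw : v < w) : (E.state t).Anc v w := by
  have hF := E.postordered ht.lt_len.le
  obtain ⟨hjv, l, hl, hlv⟩ := exists_anc_of_mem_I hv ht
  obtain ⟨_, m, hm, hmw⟩ := exists_anc_of_mem_I hw ht
  -- `v` and `w` may sit above different nodes `l`, `m` of block `j`. Postorder makes the later of
  -- the two a common descendant; when this is `m`, it precedes `v` because `v` lies in a higher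
  -- block.
  rcases le_total m l with hml | hlm
  · exact hF.anc_of_common hlv.ancEq
      (hF.anc_of_le_of_lt hlv.alive_left hmw hml ((hF.anc_lt hlv).trans hvw)).ancEq hvw
  · have hmv : m < v := lt_of_not_ge fun h =>
      absurd (block_mono ess B h) (not_le.2 (hm.symm ▸ hjv))
    exact hF.anc_of_common (hF.anc_of_le_of_lt hmw.alive_left hlv hlm hmv).ancEq hmw.ancEq hvw

/-- `I_j` is convex in the forest at the commencement of epoch `j`. -/
theorem mem_I_of_ancEq {j t : ℕ} {u v w : Fin N} (ht : E.Commences B j t) (hu : u ∈ E.I B j)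
    (hw : w ∈ E.I B j) (huv : (E.state t).AncEq u v) (hvw : (E.state t).AncEq v w) :
    v ∈ E.I B j := by
  obtain ⟨s, hs, x, _, hx, _, hxu, _⟩ := hu
  obtain ⟨s', hs', _, y, _, hy, _, hwy⟩ := hw
  obtain rfl := hs.unique ht
  obtain rfl := hs'.unique ht
  exact ⟨_, ht, x, y, hx, hy, hxu.trans huv, hvw.trans hwy⟩

/-- Nodes of a dense epoch `a` cannot enclose two exposed nodes of a later epoch `b` in the way
the sequence `babba` requires. -/
theorem false_of_interleaved {a b : ℕ} (hab : a < b) (ha : E.Dense B a) {v₁ v₂ v₃ v₄ v₅ : Fin N}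
    (h₁ : v₁ ∈ E.exposed B b) (h₂ : v₂ ∈ E.exposed B a) (h₃ : v₃ ∈ E.exposed B b)
    (h₄ : v₄ ∈ E.exposed B b) (h₅ : v₅ ∈ E.exposed B a) (h₁₂ : v₁ ≤ v₂) (h₂₃ : v₂ < v₃)
    (h₃₄ : v₃ < v₄) (h₄₅ : v₄ ≤ v₅) : False := by
  obtain ⟨h₁, -⟩ := h₁
  obtain ⟨h₂, -, s, hs, -⟩ := h₂
  obtain ⟨h₃, -, t, ht, hexp⟩ := h₃
  obtain ⟨h₄, hess, -⟩ := h₄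
  obtain ⟨h₅, -⟩ := h₅
  have hst := hs.le_of_lt ht hab
  have hF := E.postordered hs.lt_len.le
  have h₂₅ := anc_of_mem_I hs h₂ h₅ (h₂₃.trans (h₃₄.trans_le h₄₅))
  have mem : ∀ v, v ∈ E.I B b → v₂ < v → v ≤ v₅ → v ∈ E.affiliated B a := by
    intro v hv h₂v hv₅
    -- The role of `v₁`: it puts `v₂` in the subtree of `v` when epoch `a` commences.
    have h₁v := E.anc_antitone hst ht.lt_len.le (anc_of_mem_I ht h₁ hv (h₁₂.trans_lt h₂v))
    have h₂v' := hF.anc_of_le_of_lt h₂₅.alive_left h₁v h₁₂ h₂v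
    have hvI : v ∈ E.I B a := by
      rcases hv₅.eq_or_lt with rfl | hv₅
      · exact h₅
      · exact mem_I_of_ancEq hs h₂ h₅ h₂v'.ancEq
          (hF.anc_of_common h₂v'.ancEq h₂₅.ancEq hv₅).ancEq
    rw [E.affiliated_eq, if_pos ha]
    exact hvI
  exact hexp v₄ (anc_of_mem_I ht h₃ h₄ h₃₄) hess (Or.inr ⟨a, hab,
    mem v₃ h₃ h₂₃ (h₃₄.le.trans h₄₅), mem v₄ h₄ (h₂₃.trans h₃₄) h₄₅⟩)

/-! ### From nodes to subsequences of the transcription. -/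

variable (E B)

/-- The transcription, with each entry accompanied by the node in whose label it occurs. -/
noncomputable def annotated : List (Fin N × ℕ) :=
  (List.finRange N).flatMap fun v => (E.label B v).map (Prod.mk v)

theorem map_snd_annotated : (E.annotated B).map Prod.snd = E.transcription B := by
  simp [annotated, transcription, List.map_flatMap, Function.comp_def]

variable {E B}

theorem dense_of_mem_annotated {x : Fin N × ℕ} (hx : x ∈ E.annotated B) :
    E.Dense B x.2 ∧ x.1 ∈ E.exposed B x.2 := by
  obtain ⟨v, j⟩ := x
  simp only [annotated, label, List.mem_flatMap, List.mem_map, List.mem_reverse,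
    List.mem_filter, Prod.mk.injEq, decide_eq_true_eq] at hx
  obtain ⟨_, _, _, ⟨_, h⟩, rfl, rfl⟩ := hx
  exact h

/-- This order shows when consecutive symbols of a subsequence must come from distinct nodes: a
repeated symbol, or an ascent, cannot occur within one strictly descending label. -/
theorem annotated_pairwise :
    (E.annotated B).Pairwise fun x y => x.1 < y.1 ∨ x.1 = y.1 ∧ y.2 < x.2 := by
  rw [annotated, List.pairwise_flatMap]
  refine ⟨fun v _ => ?_, ?_⟩
  · rw [List.pairwise_map, label, List.pairwise_reverse]
    exact (List.Pairwise.filter _ List.pairwise_lt_range).imp fun h => Or.inr ⟨rfl, h⟩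
  · refine (List.pairwise_lt_finRange N).imp fun {v w} h x hx y hy => ?_
    obtain ⟨_, _, rfl⟩ := List.mem_map.1 hx
    obtain ⟨_, _, rfl⟩ := List.mem_map.1 hy
    exact Or.inl h

theorem not_babba_sublist_transcription {a b : ℕ} (hab : a < b) :
    ¬ [b, a, b, b, a].Sublist (E.transcription B) := by
  rw [← map_snd_annotated, List.sublist_map_iff]
  rintro ⟨l, hl, h⟩
  have hp := annotated_pairwise.sublist hl
  have hm : ∀ x ∈ l, _ := fun x hx => dense_of_mem_annotated (hl.subset hx)
  match l, h with
  | [(v₁, _), (v₂, _), (v₃, _), (v₄, _), (v₅, _)], h =>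
    simp only [List.map_cons, List.map_nil, List.cons.injEq, and_true] at h
    obtain ⟨rfl, rfl, rfl, rfl, rfl⟩ := h
    simp only [List.mem_cons, List.not_mem_nil, or_false, forall_eq_or_imp, forall_eq] at hm
    obtain ⟨h₁, h₂, h₃, h₄, h₅⟩ := hm
    simp only [List.pairwise_cons, List.mem_cons, List.not_mem_nil, or_false, forall_eq_or_imp,
      forall_eq, lt_self_iff_false, and_false] at hp
    -- The ascent `a b` gives `v₂ < v₃` and the repetition `b b` gives `v₃ < v₄`; the descents `b a`
    -- allow equal nodes.
    exact false_of_interleaved hab h₂.1 h₁.2 h₂.2 h₃.2 h₄.2 h₅.2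
      (hp.1.1.elim le_of_lt fun h => h.1.le)
      (hp.2.1.1.elim id fun h => absurd h.2 hab.not_gt) hp.2.2.1.1
      (hp.2.2.2.1.elim le_of_lt fun h => h.1.le)

/-- A sequence over two symbols that contains `babba` and `abaab` is not isomorphic to a
subsequence of the transcription. -/
theorem not_isoSubsequence_transcription {σ : List (Fin 2)}
    (h₀ : [0, 1, 0, 0, 1].Sublist σ) (h₁ : [1, 0, 1, 1, 0].Sublist σ) :
    ¬ IsoSubsequence σ (E.transcription B) := by
  rintro ⟨f, hf, h⟩
  have hne : f 0 ≠ f 1 := fun h =>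
    absurd (hf (h₀.subset (by simp)) (h₀.subset (by simp)) h) (by decide)
  -- The larger of `f 0`, `f 1` plays the later epoch `b`.
  rcases hne.lt_or_gt with hlt | hlt
  · exact not_babba_sublist_transcription hlt ((h₁.map f).trans h)
  · exact not_babba_sublist_transcription hlt ((h₀.map f).trans h)

end Execution

end SpinalCompression

theorem mainTheorem3 {N : ℕ} (hN : 0 < N) (ess : Fin N → Prop) (hbottom : ess ⟨0, hN⟩)
    (B : ℕ) (hB : 0 < B) (E : SpinalCompression.Execution ess) :
    ¬ SpinalCompression.IsoSubsequence ([0, 1, 0, 0, 1, 1, 0] : List (Fin 2))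
        (E.transcription B) ∧
    ¬ SpinalCompression.IsoSubsequence ([0, 1, 0, 1, 0, 1, 0] : List (Fin 2))
        (E.transcription B) ∧
    ∀ a b : ℕ, a < b → ¬ [b, a, b, b, a].Sublist (E.transcription B) := by
  open SpinalCompression.Execution in
  exact ⟨not_isoSubsequence_transcription (by decide) (by decide),
    not_isoSubsequence_transcription (by decide) (by decide),
    fun _ _ hab => not_babba_sublist_transcription hab⟩
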